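/- Let $\mathbb K$ be $\mathbb R$ or $\mathbb C$, let $G$ be a finite-dimensional Lie group over $\mathbb K$ with identity $e$, Lie algebra $\mathfrak g$ and adjoint representation $\mathrm{Ad}$. Let $X$ be a finite set, $F=\langle X\rangle$ the free group on $X$, $(r_j)_{j\in R}$ a finite family of elements of $F$ (the relators), $N$ the normal closure of $\{r_j : j\in R\}$ in $F$, and $\Pi=F/N$. Each word $w\in F$ defines a map $\tilde w\colon G^X\to G$ by substituting elements of $G$ for the generators. Let $\mathbf r=(\tilde r_j)_{j\in R}\colon G^X\to G^R$; the set $\mathrm{Hom}(\Pi,G)$ is identified with $\mathbf r^{-1}(e,\dots,e)\subset G^X$ by $\phi\mapsto(\phi(x))_{x\in X}$. Fix $\phi\in\mathrm{Hom}(\Pi,G)$ and let $\mathfrak g_{\mathrm{Ad}\,\phi}$ be $\mathfrak g$ with the action of $\Pi$ through $\mathrm{Ad}\circ\phi$. Identify $T_\phi G^X$ with $\mathfrak g^X$ through the infinitesimal action of $G$ on itself by left multiplication, $\xi\mapsto\frac{d}{dt}\big|_{t=0}\exp(t\xi)g\in T_gG$, in each factor, and $T_{(e,\dots,e)}G^R$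 with $\mathfrak g^R$. Let $Z^1(\Pi,\mathfrak g_{\mathrm{Ad}\,\phi})$ be the space of maps $c\colon\Pi\to\mathfrak g$ with $c(ab)=c(a)+\mathrm{Ad}_{\phi(a)}c(b)$. Let $\mathrm{Hom}(N,\mathfrak g_{\mathrm{Ad}\,\phi})^\Pi$ be the space of group homomorphisms $\beta\colon N\to\mathfrak g$ that are invariant under the action of $\Pi$ induced by $(s\cdot\beta)(n)=\mathrm{Ad}_{\phi(s)}\beta(s^{-1}ns)$, $s\in F$, and let $\mathrm{ev}_R\colon\mathrm{Hom}(N,\mathfrak g_{\mathrm{Ad}\,\phi})^\Pi\to\mathfrak g^R$, $\beta\mapsto(\beta(r_j))_{j\in R}$. Then $\mathbf r$ is differentiable at $\phi$, and its differential $(d\mathbf r)_\phi\colon\mathfrak g^X\to\mathfrak g^R$ has the following properties. 1. The restriction to the generators, $c\mapsto(c(\bar x))_{x\in X}$, where $\bar x\in\Pi$ is the class of $x$, embeds $Z^1(\Pi,\mathfrak g_{\mathrm{Ad}\,\phi})$ in $\mathfrak g^X$, and its image is $\ker(d\mathbf r)_\phi$; that is, $\ker(d\mathbf r)_\phi=Z^1(\Pi,\mathfrak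 g_{\mathrm{Ad}\,\phi})$. 2. The map $\mathrm{ev}_R$ is injective, and $\mathrm{im}(d\mathbf r)_\phi$ is contained in $\mathrm{im}(\mathrm{ev}_R)\cong\mathrm{Hom}(N,\mathfrak g_{\mathrm{Ad}\,\phi})^\Pi$. 3. The spaces $\mathrm{Hom}(N,\mathfrak g_{\mathrm{Ad}\,\phi})^\Pi$ and $H^2(\Pi,\mathfrak g_{\mathrm{Ad}\,\phi})$ (group cohomology) are finite-dimensional over $\mathbb K$, and $$\mathrm{rank}(d\mathbf r)_\phi=\dim\mathrm{Hom}(N,\mathfrak g_{\mathrm{Ad}\,\phi})^\Pi-\dim H^2(\Pi,\mathfrak g_{\mathrm{Ad}\,\phi}).$$ 4. If $\mathrm{Hom}(N,\mathfrak g_{\mathrm{Ad}\,\phi})^\Pi\cong\mathfrak g^R$ as vector spaces, then $\mathrm{coker}(d\mathbf r)_\phi\cong H^2(\Pi,\mathfrak g_{\mathrm{Ad}\,\phi})$ as vector spaces. -/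

import Mathlib

open scoped Manifold ContDiff

universe u

noncomputable section

/-! ### The adjoint representation of a Lie group -/

section Adjoint

variable {𝕜 : Type*} [NontriviallyNormedField 𝕜]
  {E : Type*} [NormedAddCommGroup E] [NormedSpace 𝕜 E]
  {H : Type*} [TopologicalSpace H] (I : ModelWithCorners 𝕜 E H)
  {G : Type*} [TopologicalSpace G] [ChartedSpace H G] [Group G]

/-- The derivative at the identity of the conjugation `h ↦ g * h * g⁻¹`, as an endomorphism of
the Lie algebra (recall that `g * 1 * g⁻¹ = 1`). -/
def lieAd (g : G) : GroupLieAlgebra I G →L[𝕜] GroupLieAlgebra I G :=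
  mfderiv I I (fun h : G => g * h * g⁻¹) 1

theorem lieAd_one : lieAd I (1 : G) = ContinuousLinearMap.id 𝕜 (GroupLieAlgebra I G) := by
  have h1 : (fun h : G => (1 : G) * h * (1 : G)⁻¹) = id := by
    funext h; simp
  unfold lieAd
  rw [h1]
  exact mfderiv_id

variable [LieGroup I ∞ G]

theorem mdifferentiableAt_conj (g h : G) :
    MDifferentiableAt I I (fun h : G => g * h * g⁻¹) h := by
  have h1 : ContMDiff I I ∞ (fun h : G => g * h * g⁻¹) :=
    (contMDiff_mul_right (a := g⁻¹)).comp (contMDiff_mul_left (a := g))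
  exact h1.mdifferentiableAt (by simp)

theorem lieAd_mul (a b : G) : lieAd I (a * b) = (lieAd I a).comp (lieAd I b) := by
  have h1 : (fun h : G => (a * b) * h * (a * b)⁻¹)
      = (fun h : G => a * h * a⁻¹) ∘ (fun h : G => b * h * b⁻¹) := by
    funext h; simp [mul_assoc]
  have h2 : b * 1 * b⁻¹ = (1 : G) := by simp
  have h3 : ∀ x : G, x = 1 →
      ((mfderiv I I (fun h : G => a * h * a⁻¹) x : E →L[𝕜] E)
        = (mfderiv I I (fun h : G => a * h * a⁻¹) (1 : G) : E →L[𝕜] E)) := by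
    rintro _ rfl; rfl
  have h4 := mfderiv_comp_of_eq (y := b * 1 * b⁻¹) (mdifferentiableAt_conj I a (b * 1 * b⁻¹))
    (mdifferentiableAt_conj I b 1) rfl
  rw [← h1] at h4
  refine Eq.trans h4 ?_
  exact congrArg (fun L : E →L[𝕜] E => L.comp (lieAd I b : E →L[𝕜] E)) (h3 _ h2)

variable (G) in
/-- The adjoint representation `Ad` of the Lie group `G` on its Lie algebra `𝔤`. -/
def adjointRep : Representation 𝕜 G (GroupLieAlgebra I G) where
  toFun g := (lieAd I g : GroupLieAlgebra I G →ₗ[𝕜] GroupLieAlgebra I G)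
  map_one' := by rw [lieAd_one]; rfl
  map_mul' a b := by rw [lieAd_mul]; rfl

end Adjoint

/-! ### The `F ⧸ N`-module `Hom(N, V)` -/

section HomModule

variable {𝕜 : Type*} [CommRing 𝕜] {F : Type*} [Group F] (N : Subgroup F) [N.Normal]
  {V : Type*} [AddCommGroup V] [Module 𝕜 V]

/-- For a representation `ρ` of `F ⧸ N` on `V`, the group `F` acts on `Hom(N, V)`
(group homomorphisms from `N` to the additive group `V`) through conjugation on `N` and `ρ` on `V`:
`(s • β)(n) = ρ(s)(β(s⁻¹ * n * s))`. -/
def conjHomRep (ρ : Representation 𝕜 (F ⧸ N) V) : Representation 𝕜 F (Additive N →+ V) where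
  toFun s :=
    { toFun := fun β =>
        ((ρ (s : F ⧸ N)).toAddMonoidHom.comp β).comp
          (MonoidHom.toAdditive (MulAut.conjNormal s⁻¹ : N ≃* N).toMonoidHom)
      map_add' := fun β γ => by ext n; simp
      map_smul' := fun c β => by ext n; simp }
  map_one' := by ext β n; simp
  map_mul' s t := by ext β n; simp

theorem conjHomRep_apply (ρ : Representation 𝕜 (F ⧸ N) V) (s : F) (β : Additive N →+ V)
    (n : N) :
    conjHomRep N ρ s β (Additive.ofMul n)
      = ρ (s : F ⧸ N) (β (Additive.ofMul (MulAut.conjNormal s⁻¹ n))) := rfl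

/-- `N` acts trivially on `Hom(N, V)`. -/
instance conjHomRep_isTrivial (ρ : Representation 𝕜 (F ⧸ N) V) :
    Representation.IsTrivial ((conjHomRep N ρ).comp N.subtype) where
  out s := by
    ext β n
    obtain ⟨n, rfl⟩ := Additive.ofMul.surjective n
    have h1 : ((s : F) : F ⧸ N) = 1 := (QuotientGroup.eq_one_iff (s : F)).2 s.2
    have h2 : (MulAut.conjNormal (s : F)⁻¹ n : N) = s⁻¹ * n * s := by
      ext; simp
    change conjHomRep N ρ (s : F) β (Additive.ofMul n) = β (Additive.ofMul n)
    rw [conjHomRep_apply, h1, h2]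
    simp [ofMul_mul, ofMul_inv]

/-- The induced action of `F ⧸ N` on `Hom(N, V)`. -/
def quotientHomRep (ρ : Representation 𝕜 (F ⧸ N) V) :
    Representation 𝕜 (F ⧸ N) (Additive N →+ V) :=
  Representation.ofQuotient (conjHomRep N ρ) N

/-- The space `Hom(N, V)^(F ⧸ N)` of invariant homomorphisms. -/
abbrev InvariantHom (ρ : Representation 𝕜 (F ⧸ N) V) : Submodule 𝕜 (Additive N →+ V) :=
  (quotientHomRep N ρ).invariants

/-- Evaluation of invariant homomorphisms at a family of elements of `N`. -/
def evalInvariantHom (ρ : Representation 𝕜 (F ⧸ N) V) {R : Type*} (r : R → N) :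
    InvariantHom N ρ →ₗ[𝕜] (R → V) where
  toFun β := fun j => (β : Additive N →+ V) (Additive.ofMul (r j))
  map_add' _ _ := rfl
  map_smul' _ _ := rfl

end HomModule

/-! ### Finite presentations and the relator map -/

section Presentation

variable {X R : Type*} (r : R → FreeGroup X)

/-- The normal closure `N` of the relators in the free group `F = ⟨X⟩`. -/
abbrev relatorSubgroup : Subgroup (FreeGroup X) := Subgroup.normalClosure (Set.range r)

/-- The group `Π = F ⧸ N` with generators `X` and relators `r`. -/
abbrev PresGroup : Type _ := FreeGroup X ⧸ relatorSubgroup r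

/-- The image in `Π` of a generator. -/
def presGen (x : X) : PresGroup r := QuotientGroup.mk (FreeGroup.of x)

/-- The relators, as elements of `N`. -/
def relator (j : R) : relatorSubgroup r :=
  ⟨r j, Subgroup.subset_normalClosure (Set.mem_range_self j)⟩

variable {G : Type*} [Group G]

/-- The map `w̃ : G^X → G` that substitutes elements of `G` for the generators in a word `w`. -/
def wordMap (w : FreeGroup X) (g : X → G) : G := FreeGroup.lift g w

/-- The relator map `G^X → G^R`. -/
def relatorMap (g : X → G) : R → G := fun j => wordMap (r j) g

/-- The point of `G^X = Hom(F, G)` that corresponds to `φ ∈ Hom(Π, G)`. -/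
def homPoint (φ : PresGroup r →* G) : X → G := fun x => φ (presGen r x)

/-- At the points of `Hom(Π, G)` the relator map takes the value `(e, …, e)`. -/
theorem relatorMap_homPoint (φ : PresGroup r →* G) : relatorMap r (homPoint r φ) = 1 := by
  have h1 : FreeGroup.lift (homPoint r φ) = φ.comp (QuotientGroup.mk' (relatorSubgroup r)) := by
    ext x; simp [homPoint, presGen]
  funext j
  have h2 : ((r j : FreeGroup X) : PresGroup r) = 1 :=
    (QuotientGroup.eq_one_iff (r j)).2 (relator r j).2
  simp [relatorMap, wordMap, h1, h2]

end Presentation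

section Differential

variable {𝕜 : Type*} [NontriviallyNormedField 𝕜]
  {E : Type*} [NormedAddCommGroup E] [NormedSpace 𝕜 E]
  {H : Type*} [TopologicalSpace H] (I : ModelWithCorners 𝕜 E H)
  {G : Type*} [TopologicalSpace G] [ChartedSpace H G] [Group G]

/-- The identification `𝔤 → T_g G` given by the infinitesimal action of `G` on itself by left
multiplication, `ξ ↦ d/dt exp(t ξ) g`; it is the derivative at the identity of `h ↦ h * g`. -/
def lieTransport (g : G) : GroupLieAlgebra I G →L[𝕜] TangentSpace I g :=
  mfderiv I I (fun h : G => h * g) 1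

/-- The induced identification `𝔤^X → T_g (G^X)` at a point `g` of the product manifold `G^X`
(whose tangent space is by construction the product of the tangent spaces of the factors). -/
def lieTransportPi {X : Type*} [Fintype X] (g : X → G) :
    (X → GroupLieAlgebra I G) →ₗ[𝕜] TangentSpace (ModelWithCorners.pi fun _ : X => I) g :=
  (LinearMap.pi fun x =>
    ((lieTransport I (g x)).toLinearMap.comp (LinearMap.proj x) :
      (X → GroupLieAlgebra I G) →ₗ[𝕜] E) : (X → GroupLieAlgebra I G) →ₗ[𝕜] (X → E))

/-- The differential at `φ ∈ Hom(Π, G)` of the relator map `G^X → G^R`, as a linear map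
`𝔤^X → 𝔤^R`. The source is the tangent space of `G^X` at `φ`, identified with `𝔤^X` by
`lieTransportPi`; the target is the tangent space of `G^R` at `(e, …, e)`, which is `𝔤^R`. -/
def relatorDifferential {X R : Type*} [Fintype X] [Fintype R] (r : R → FreeGroup X)
    (φ : PresGroup r →* G) :
    (X → GroupLieAlgebra I G) →ₗ[𝕜] (R → GroupLieAlgebra I G) :=
  (mfderiv (ModelWithCorners.pi fun _ : X => I) (ModelWithCorners.pi fun _ : R => I)
    (relatorMap r : (X → G) → (R → G)) (homPoint r φ)).toLinearMap.comp
      (lieTransportPi I (homPoint r φ))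

variable [LieGroup I ∞ G]

/-- The representation `Ad ∘ φ` of `Π` on `𝔤`. -/
def adRep {Q : Type*} [Group Q] (φ : Q →* G) : Representation 𝕜 Q (GroupLieAlgebra I G) :=
  (adjointRep I G).comp φ

end Differential

end

/-!
Translated back to the identity, the differentials at `φ` of the word maps form a 1-cocycle on `F`:
the product rule reads `d(st) = ds + Ad_{φ(s)} dt`. A 1-cocycle on a free group has arbitrary values
at the generators, so the differential of the relator map is the composite
`𝔤^X ≃ Z¹(F, 𝔤) → Hom(N, 𝔤)^Π → 𝔤^R` of the restriction to `N` with the evaluation at the relators.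
The evaluation is injective because `N` is the normal closure of the relators, and everything else
is read off the exact sequence

  `0 → Z¹(Π, 𝔤) → Z¹(F, 𝔤) → Hom(N, 𝔤)^Π → H²(Π, 𝔤) → H²(F, 𝔤) = 0`,

in which `Hom(N, 𝔤)^Π → H²(Π, 𝔤)` is the transgression.
-/

noncomputable section

open groupCohomology CategoryTheory

section Inflation

variable {k F Q : Type u} [CommRing k] [Group F] [Group Q] {π : F →* Q} {A : Rep.{u} k Q}

theorem d₁₂_res_comp (c : Q → A) :
    (d₁₂ (Rep.res π A)).hom (c ∘ π) = (d₁₂ A).hom c ∘ Prod.map π π := by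
  ext ⟨s, t⟩
  simp [map_mul]

theorem comp_mem_cocycles₁_res_iff (hπ : Function.Surjective π) {c : Q → A} :
    c ∘ π ∈ cocycles₁ (Rep.res π A) ↔ c ∈ cocycles₁ A := by
  change (d₁₂ (Rep.res π A)).hom (c ∘ π) = 0 ↔ (d₁₂ A).hom c = 0
  rw [d₁₂_res_comp]
  exact (hπ.prodMap hπ).injective_comp_right.eq_iff' rfl

theorem comp_mem_cocycles₂_res_iff (hπ : Function.Surjective π) {f : Q × Q → A} :
    f ∘ Prod.map π π ∈ cocycles₂ (Rep.res π A) ↔ f ∈ cocycles₂ A := by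
  rw [mem_cocycles₂_iff, mem_cocycles₂_iff, hπ.forall₃]
  simp [map_mul]

end Inflation

section NormalSubgroup

variable {k : Type u} [CommRing k] {F : Type u} [Group F] {N : Subgroup F}
  {V : Type u} [AddCommGroup V]

/-- `h` intertwines the action of `N` on `F` by left multiplication with its action on `V` by
translations through `β`. The functions with `h 1 = 0` among these extend `β`. -/
def IsEquivariantAlong (β : Additive N →+ V) (h : F → V) : Prop :=
  ∀ (n : N) (s : F), h (n * s) = β (.ofMul n) + h s

theorem IsEquivariantAlong.apply_coe {β : Additive N →+ V} {h : F → V}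
    (hh : IsEquivariantAlong β h) (n : N) : h n = β (.ofMul n) + h 1 := by
  simpa using hh n 1

variable [N.Normal]

theorem mul_coe_eq_conjNormal_mul (s : F) (n : N) : s * n = (MulAut.conjNormal s n : N) * s := by
  simp

theorem quotient_mk_coe_eq_one (n : N) : ((n : F) : F ⧸ N) = 1 := (QuotientGroup.eq_one_iff _).2 n.2

theorem IsEquivariantAlong.exists_sub_eq_comp_mk {β : Additive N →+ V} {h h' : F → V}
    (hh : IsEquivariantAlong β h) (hh' : IsEquivariantAlong β h') :
    ∃ c : F ⧸ N → V, h - h' = c ∘ QuotientGroup.mk' N := by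
  refine ⟨fun a => (h - h') a.out, funext fun s => ?_⟩
  obtain ⟨n, hn⟩ := QuotientGroup.mk_out_eq_mul N s
  change (h - h') s = (h - h') (s : F ⧸ N).out
  rw [hn, mul_coe_eq_conjNormal_mul, Pi.sub_apply, Pi.sub_apply, hh, hh', add_sub_add_left_eq_sub]

variable [Module k V] {ρ : Representation k (F ⧸ N) V}

theorem mem_invariantHom_iff {β : Additive N →+ V} :
    β ∈ InvariantHom N ρ ↔ ∀ (s : F) (n : N),
      β (.ofMul (MulAut.conjNormal s n)) = ρ (s : F ⧸ N) (β (.ofMul n)) := by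
  calc β ∈ InvariantHom N ρ
    _ ↔ ∀ s : F, conjHomRep N ρ s β = β := QuotientGroup.forall_mk
    _ ↔ _ := forall_congr' fun s => by
      rw [DFunLike.ext_iff,
        ← ((MulAut.conjNormal s).toEquiv.trans Additive.ofMul).forall_congr_right]
      refine forall_congr' fun n => ?_
      change conjHomRep N ρ s β (.ofMul (MulAut.conjNormal s n)) = _ ↔ _
      rw [conjHomRep_apply, ← MulAut.mul_apply, ← map_mul, inv_mul_cancel, map_one]
      exact eq_comm

theorem IsEquivariantAlong.mem_invariantHom_iff {β : Additive N →+ V} {h : F → V}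
    (hh : IsEquivariantAlong β h) :
    β ∈ InvariantHom N ρ ↔ ∀ (s : F) (n : N), h (s * n) = ρ (s : F ⧸ N) (β (.ofMul n)) + h s := by
  rw [_root_.mem_invariantHom_iff]
  refine forall₂_congr fun s n => ?_
  rw [mul_coe_eq_conjNormal_mul, hh, add_left_inj]

variable (N ρ) in
/-- The representation of `F` obtained from a representation of `F ⧸ N`. -/
abbrev inflation : Rep.{u} k F := Rep.res (QuotientGroup.mk' N) (Rep.of ρ)

theorem d₁₂_inflation_apply (h : F → V) (s t : F) :
    (d₁₂ (inflation N ρ)).hom h (s, t) = ρ (s : F ⧸ N) (h t) - h (s * t) + h s := rfl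

theorem mem_cocycles₁_inflation_iff {D : F → V} :
    D ∈ cocycles₁ (inflation N ρ) ↔ ∀ s t, D (s * t) = ρ (s : F ⧸ N) (D t) + D s :=
  mem_cocycles₁_iff (A := inflation N ρ) D

theorem isEquivariantAlong_of_mem_cocycles₁ {D : F → V} (hD : D ∈ cocycles₁ (inflation N ρ))
    {β : Additive N →+ V} (hβ : ∀ n : N, D n = β (.ofMul n)) : IsEquivariantAlong β D :=
  fun n s => by
    rw [mem_cocycles₁_inflation_iff.1 hD, quotient_mk_coe_eq_one, map_one, hβ, add_comm,
      Module.End.one_apply]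

variable (N ρ) in
/-- The restriction to `N` of a 1-cocycle on `F`. -/
def cocycleRestriction : cocycles₁ (inflation N ρ) →ₗ[k] InvariantHom N ρ where
  toFun D :=
    let β : Additive N →+ V := .mk' (fun n => D.1 n.toMul) fun m n => by
      refine (mem_cocycles₁_inflation_iff.1 D.2 _ _).trans ?_
      rw [quotient_mk_coe_eq_one, map_one, add_comm, Module.End.one_apply]
    ⟨β, (isEquivariantAlong_of_mem_cocycles₁ D.2 fun _ => rfl).mem_invariantHom_iff.2
      fun s n => mem_cocycles₁_inflation_iff.1 D.2 s n⟩
  map_add' _ _ := rfl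
  map_smul' _ _ := rfl

theorem isEquivariantAlong_cocycleRestriction (D : cocycles₁ (inflation N ρ)) :
    IsEquivariantAlong (cocycleRestriction N ρ D).1 D :=
  isEquivariantAlong_of_mem_cocycles₁ D.2 fun _ => rfl

theorem cocycleRestriction_eq_zero_iff {D : cocycles₁ (inflation N ρ)} :
    cocycleRestriction N ρ D = 0 ↔ ∃ c ∈ cocycles₁ (Rep.of ρ), ⇑D = c ∘ QuotientGroup.mk' N := by
  constructor
  · intro hD
    have hD' : IsEquivariantAlong (0 : Additive N →+ V) D := by
      have := isEquivariantAlong_cocycleRestriction D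
      rwa [hD] at this
    obtain ⟨c, hc⟩ := hD'.exists_sub_eq_comp_mk (h' := 0) fun _ _ => (add_zero 0).symm
    rw [sub_zero] at hc
    refine ⟨c, ?_, hc⟩
    rw [← comp_mem_cocycles₁_res_iff (QuotientGroup.mk'_surjective N), ← hc]
    exact D.2
  · rintro ⟨c, hc, hD⟩
    ext n
    obtain ⟨n, rfl⟩ := Additive.ofMul.surjective n
    calc D.1 n = c (n : F) := congrFun hD n
      _ = 0 := by rw [quotient_mk_coe_eq_one]; exact cocycles₁_map_one ⟨c, hc⟩

theorem IsEquivariantAlong.d₁₂_mul_mul {β : Additive N →+ V} {h : F → V}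
    (hh : IsEquivariantAlong β h) (hβ : β ∈ InvariantHom N ρ) (m n : N) (s t : F) :
    (d₁₂ (inflation N ρ)).hom h (m * s, n * t) = (d₁₂ (inflation N ρ)).hom h (s, t) := by
  have hst : h (m * s * (n * t))
      = β (.ofMul m) + (ρ (s : F ⧸ N) (β (.ofMul n)) + h (s * t)) := by
    rw [mul_assoc, hh, ← mul_assoc s, mul_coe_eq_conjNormal_mul, mul_assoc, hh,
      _root_.mem_invariantHom_iff.1 hβ]
  have hms : ((m * s : F) : F ⧸ N) = s := by
    rw [QuotientGroup.mk_mul, quotient_mk_coe_eq_one, one_mul]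
  rw [d₁₂_inflation_apply, d₁₂_inflation_apply, hst, hms, hh m s, hh n t, map_add]
  abel

variable (k N V) in
/-- The extension of homomorphisms from `N` to `F` by `0` on the representatives
`Quotient.out` of the classes. -/
def extendBySection : (Additive N →+ V) →ₗ[k] (F → V) where
  toFun β s := β (.ofMul ⟨s * ((s : F ⧸ N).out)⁻¹, by
    rw [← QuotientGroup.eq_one_iff, QuotientGroup.mk_mul, QuotientGroup.mk_inv,
      QuotientGroup.out_eq', mul_inv_cancel]⟩)
  map_add' _ _ := rfl
  map_smul' _ _ := rfl

theorem isEquivariantAlong_extendBySection (β : Additive N →+ V) :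
    IsEquivariantAlong β (extendBySection k N V β) := fun n s => by
  have hns : ((n * s : F) : F ⧸ N) = s := by
    rw [QuotientGroup.mk_mul, quotient_mk_coe_eq_one, one_mul]
  refine Eq.trans ?_ (map_add β _ _)
  refine congrArg β (congrArg Additive.ofMul (Subtype.ext ?_))
  simp [hns, mul_assoc]

variable (N ρ) in
/-- The coboundary of `extendBySection β` on `F`, as a function on `F ⧸ N`. -/
def transgressionCochain : (Additive N →+ V) →ₗ[k] ((F ⧸ N) × (F ⧸ N) → V) :=
  LinearMap.funLeft k V (Prod.map Quotient.out Quotient.out) ∘ₗ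
    (d₁₂ (inflation N ρ)).hom ∘ₗ extendBySection k N V

theorem transgressionCochain_comp_mk {β : Additive N →+ V} (hβ : β ∈ InvariantHom N ρ) :
    transgressionCochain N ρ β ∘ Prod.map (QuotientGroup.mk' N) (QuotientGroup.mk' N)
      = (d₁₂ (inflation N ρ)).hom (extendBySection k N V β) := by
  ext ⟨s, t⟩
  obtain ⟨m, hm⟩ := QuotientGroup.mk_out_eq_mul N s
  obtain ⟨n, hn⟩ := QuotientGroup.mk_out_eq_mul N t
  change (d₁₂ (inflation N ρ)).hom _ ((s : F ⧸ N).out, (t : F ⧸ N).out) = _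
  rw [hm, hn, mul_coe_eq_conjNormal_mul, mul_coe_eq_conjNormal_mul,
    (isEquivariantAlong_extendBySection β).d₁₂_mul_mul hβ]

theorem transgressionCochain_mem_cocycles₂ {β : Additive N →+ V} (hβ : β ∈ InvariantHom N ρ) :
    transgressionCochain N ρ β ∈ cocycles₂ (Rep.of ρ) := by
  rw [← comp_mem_cocycles₂_res_iff (QuotientGroup.mk'_surjective N)]
  exact (transgressionCochain_comp_mk hβ).symm ▸ d₁₂_apply_mem_cocycles₂ _

variable (N ρ) in
/-- The transgression `Hom(N, V)^(F ⧸ N) → H²(F ⧸ N, V)`, which sends `β` to the class of the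
coboundary of an extension of `β` to `F`. -/
def transgression : InvariantHom N ρ →ₗ[k] H2 (Rep.of ρ) :=
  (H2π (Rep.of ρ)).hom ∘ₗ ((transgressionCochain N ρ).restrict
    fun _ hβ => transgressionCochain_mem_cocycles₂ hβ)

theorem transgression_eq_of_d₁₂_eq {β : InvariantHom N ρ} {h : F → V}
    (hh : IsEquivariantAlong β.1 h) {f : cocycles₂ (Rep.of ρ)}
    (hf : (d₁₂ (inflation N ρ)).hom h
      = f ∘ Prod.map (QuotientGroup.mk' N) (QuotientGroup.mk' N)) :
    transgression N ρ β = H2π (Rep.of ρ) f := by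
  obtain ⟨c, hc⟩ := (isEquivariantAlong_extendBySection (k := k) β.1).exists_sub_eq_comp_mk hh
  refine (H2π_eq_iff _ _).2 ⟨c, ?_⟩
  have hπ := QuotientGroup.mk'_surjective N
  apply (hπ.prodMap hπ).injective_comp_right
  calc (d₁₂ (Rep.of ρ)).hom c ∘ Prod.map (QuotientGroup.mk' N) (QuotientGroup.mk' N)
    _ = (d₁₂ (inflation N ρ)).hom (c ∘ QuotientGroup.mk' N) := (d₁₂_res_comp (A := Rep.of ρ) c).symm
    _ = (d₁₂ (inflation N ρ)).hom (extendBySection k N V β.1)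
        - (d₁₂ (inflation N ρ)).hom h := by rw [← hc]; exact map_sub _ _ _
    _ = _ := by rw [← transgressionCochain_comp_mk β.2, hf]; rfl

theorem ker_transgression :
    LinearMap.ker (transgression N ρ) = LinearMap.range (cocycleRestriction N ρ) := by
  ext β
  constructor
  · intro hβ
    obtain ⟨c, hc⟩ := (H2π_eq_zero_iff _).1 (show transgression N ρ β = 0 from hβ)
    have hh := isEquivariantAlong_extendBySection (k := k) β.1
    let D : F → V := extendBySection k N V β.1 - c ∘ QuotientGroup.mk' N
    have hD : D ∈ cocycles₁ (inflation N ρ) := by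
      refine (map_sub (d₁₂ (inflation N ρ)).hom _ _).trans (sub_eq_zero.2 ?_)
      rw [← transgressionCochain_comp_mk β.2]
      exact (congrArg (· ∘ Prod.map _ _) hc.symm).trans (d₁₂_res_comp (A := Rep.of ρ) c).symm
    have hDβ : IsEquivariantAlong β.1 D := fun n s => by
      simp only [D, Pi.sub_apply, Function.comp_apply, hh n s, map_mul, QuotientGroup.mk'_apply,
        quotient_mk_coe_eq_one, one_mul, add_sub_assoc]
    refine ⟨⟨D, hD⟩, Subtype.ext (AddMonoidHom.ext fun n => ?_)⟩
    calc D n.toMul = β.1 n + D 1 := hDβ.apply_coe n.toMul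
      _ = β.1 n := by
        rw [show D 1 = 0 from cocycles₁_map_one (A := inflation N ρ) ⟨D, hD⟩, add_zero]
  · rintro ⟨D, rfl⟩
    refine (transgression_eq_of_d₁₂_eq (isEquivariantAlong_cocycleRestriction D) (f := 0) ?_).trans
      (map_zero _)
    exact D.2

theorem exists_isEquivariantAlong_of_d₁₂_eq {h : F → V} {f : (F ⧸ N) × (F ⧸ N) → V}
    (hf : (d₁₂ (inflation N ρ)).hom h
      = f ∘ Prod.map (QuotientGroup.mk' N) (QuotientGroup.mk' N)) :
    ∃ β : InvariantHom N ρ, IsEquivariantAlong β.1 h := by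
  have hf' (s t : F) : ρ (s : F ⧸ N) (h t) - h (s * t) + h s = f (s, t) := congrFun hf (s, t)
  have hfst (n : N) (s : F) : h (n * s) = (h n - h 1) + h s := by
    have h₁ := hf' 1 s
    have hₙ := hf' n s
    rw [one_mul, QuotientGroup.mk_one, map_one, Module.End.one_apply, sub_self, zero_add] at h₁
    rw [quotient_mk_coe_eq_one, map_one, Module.End.one_apply, ← h₁] at hₙ
    rw [← hₙ]
    abel
  have hsnd (s : F) (n : N) : h (s * n) = ρ (s : F ⧸ N) (h n - h 1) + h s := by
    have h₁ := hf' s 1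
    have hₙ := hf' s n
    rw [mul_one, QuotientGroup.mk_one, sub_add_cancel] at h₁
    rw [quotient_mk_coe_eq_one, ← h₁] at hₙ
    rw [map_sub, ← hₙ]
    abel
  let β : Additive N →+ V := .mk' (fun n => h n.toMul - h 1) fun m n => by
    change h (m.toMul * n.toMul : F) - h 1 = _
    rw [hfst, add_sub_assoc]
  have hβ : IsEquivariantAlong β h := hfst
  exact ⟨⟨β, hβ.mem_invariantHom_iff.2 hsnd⟩, hβ⟩

theorem range_transgression :
    LinearMap.range (transgression N ρ) =
      LinearMap.ker (map (QuotientGroup.mk' N) (𝟙 (inflation N ρ)) 2).hom := by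
  have map_H2π_eq_zero_iff (f : cocycles₂ (Rep.of ρ)) :
      map (QuotientGroup.mk' N) (𝟙 (inflation N ρ)) 2 (H2π (Rep.of ρ) f) = 0 ↔
        ∃ h, (d₁₂ (inflation N ρ)).hom h
          = f ∘ Prod.map (QuotientGroup.mk' N) (QuotientGroup.mk' N) := by
    rw [H2π_comp_map_apply]
    exact H2π_eq_zero_iff _
  ext y
  constructor
  · rintro ⟨β, rfl⟩
    exact (map_H2π_eq_zero_iff _).2 ⟨_, (transgressionCochain_comp_mk β.2).symm⟩
  · induction y using H2_induction_on with | h f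
    intro hf
    obtain ⟨h, hf⟩ := (map_H2π_eq_zero_iff f).1 hf
    obtain ⟨β, hβ⟩ := exists_isEquivariantAlong_of_d₁₂_eq hf
    exact ⟨β, transgression_eq_of_d₁₂_eq hβ hf⟩

end NormalSubgroup

section CocyclesOnGenerators

variable {k G : Type u} [CommRing k] [Group G] {A : Rep.{u} k G}

theorem cocycles₁_ext_of_closure_eq_top {S : Set G} (hS : Subgroup.closure S = ⊤)
    {c d : cocycles₁ A} (h : Set.EqOn c d S) : c = d := by
  refine cocycles₁_ext fun g => ?_
  have hg : g ∈ Subgroup.closure S := hS ▸ Subgroup.mem_top g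
  induction hg using Subgroup.closure_induction with
  | mem g hg => exact h hg
  | one => rw [cocycles₁_map_one, cocycles₁_map_one]
  | mul a b _ _ ha hb =>
    rw [(mem_cocycles₁_iff c).1 c.2, (mem_cocycles₁_iff d).1 d.2, ha, hb]
  | inv a _ ha =>
    apply (A.ρ.apply_bijective a).injective
    rw [cocycles₁_map_inv, cocycles₁_map_inv, ha]

end CocyclesOnGenerators

section FreeGroup

variable {k X : Type u} [CommRing k]

section FirstCohomology

variable {V : Type u} [AddCommGroup V] [Module k V] (ρ : Representation k (FreeGroup X) V)

/-- The affine action of the free group in which the generator `x` acts by `v ↦ ρ x v + ξ x`;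
its translation parts form the 1-cocycle with the value `ξ x` at each generator `x`. -/
def freeAffineAction (ξ : X → V) : FreeGroup X →* (V ≃ᵃ[k] V) :=
  FreeGroup.lift fun x =>
    (LinearMap.GeneralLinearGroup.generalLinearEquiv k V
      (ρ.asGroupHom (FreeGroup.of x))).toAffineEquiv.trans (AffineEquiv.constVAdd k V (ξ x))

theorem freeAffineAction_of_apply (ξ : X → V) (x : X) (v : V) :
    freeAffineAction ρ ξ (FreeGroup.of x) v = ξ x + ρ (FreeGroup.of x) v := by
  rw [freeAffineAction, FreeGroup.lift_apply_of]
  rfl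

theorem freeAffineAction_linear (ξ : X → V) (w : FreeGroup X) :
    ((freeAffineAction ρ ξ w).linear : V →ₗ[k] V) = ρ w := by
  have h : AffineEquiv.linearHom.comp (freeAffineAction ρ ξ)
      = (LinearMap.GeneralLinearGroup.generalLinearEquiv k V).toMonoidHom.comp ρ.asGroupHom := by
    ext x v
    simp only [MonoidHom.comp_apply, freeAffineAction, FreeGroup.lift_apply_of]
    rfl
  exact congrArg LinearEquiv.toLinearMap (DFunLike.congr_fun h w)

theorem freeAffineAction_zero_mem_cocycles₁ (ξ : X → V) :
    (fun w => freeAffineAction ρ ξ w 0) ∈ cocycles₁ (Rep.of ρ) := by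
  refine (mem_cocycles₁_iff (A := Rep.of ρ) _).2 fun s t => ?_
  have h := (freeAffineAction ρ ξ s).map_vadd 0 (freeAffineAction ρ ξ t 0)
  rw [map_mul, ← freeAffineAction_linear ρ ξ]
  simpa using h

/-- The 1-cocycles on a free group have arbitrary values at the generators and are determined by
them. -/
def freeCocycleEquiv (A : Rep.{u} k (FreeGroup X)) : cocycles₁ A ≃ₗ[k] (X → A) :=
  .ofBijective (LinearMap.funLeft k A FreeGroup.of ∘ₗ (cocycles₁ A).subtype)
    ⟨fun D D' h => cocycles₁_ext_of_closure_eq_top (FreeGroup.closure_range_of X) <|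
        Set.forall_mem_range.2 <| congrFun h,
      fun ξ => ⟨⟨_, freeAffineAction_zero_mem_cocycles₁ A.ρ ξ⟩, funext fun x =>
        (freeAffineAction_of_apply A.ρ ξ x 0).trans (by rw [map_zero, add_zero])⟩⟩

@[simp]
theorem freeCocycleEquiv_apply (A : Rep.{u} k (FreeGroup X)) (D : cocycles₁ A) (x : X) :
    freeCocycleEquiv A D x = D (FreeGroup.of x) := rfl

end FirstCohomology

theorem epi_map_H1_freeGroup {A B : Rep.{u} k (FreeGroup X)} (φ : A ⟶ B) [Epi φ] :
    Epi (map (MonoidHom.id (FreeGroup X)) φ 1) := by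
  have hφ : Function.Surjective φ.hom := (Rep.epi_iff_surjective φ).1 ‹_›
  refine (ModuleCat.epi_iff_surjective _).2 fun y => ?_
  induction y using H1_induction_on with | h D
  obtain ⟨ξ, hξ⟩ := hφ.comp_left (freeCocycleEquiv B D)
  let D' : cocycles₁ A := (freeCocycleEquiv A).symm ξ
  have hD' : mapCocycles₁ (MonoidHom.id _) φ D' = D := (freeCocycleEquiv B).injective <| by
    rw [← hξ]
    exact congrArg (φ.hom ∘ ·) ((freeCocycleEquiv A).apply_symm_apply ξ)
  refine ⟨H1π A D', ?_⟩
  rw [H1π_comp_map_apply, hD']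

theorem δ_eq_zero_of_epi_map {G : Type u} [Group G] {S : ShortComplex (Rep.{u} k G)}
    (hS : S.ShortExact) {n : ℕ} [Epi (map (MonoidHom.id G) S.g n)] :
    δ hS n (n + 1) rfl = 0 :=
  Limits.zero_of_epi_comp (map (MonoidHom.id G) S.g n) (mapShortComplex₃ hS rfl).zero

theorem isZero_groupCohomology_coind_bot {G : Type u} [Group G] (A : Rep.{u} k (⊥ : Subgroup G))
    (n : ℕ) :
    Limits.IsZero (groupCohomology (Rep.coind (⊥ : Subgroup G).subtype A) (n + 1)) :=
  (isZero_groupCohomology_succ_of_subsingleton A n).of_iso (coindIso A (n + 1))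

/-- The proof shifts degrees along the embedding of `A` in an acyclic coinduced module: a free group
lifts 1-cocycles along epimorphisms, so the connecting map `H¹ → H²` vanishes. -/
theorem isZero_H2_freeGroup (A : Rep.{u} k (FreeGroup X)) : Limits.IsZero (H2 A) := by
  let ι : A ⟶ Rep.coind (⊥ : Subgroup (FreeGroup X)).subtype (Rep.res _ A) :=
    Rep.resCoindToHom _ _ _ (𝟙 _)
  have : Mono ι := (Rep.mono_iff_injective ι).2 fun a b h => by
    have := congrFun (congrArg Subtype.val h) 1
    simpa [ι] using this
  have hS : (ShortComplex.mk ι (Limits.cokernel.π ι) (Limits.cokernel.condition ι)).ShortExact :=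
    { exact := ShortComplex.exact_cokernel ι }
  have : Epi (δ hS 1 2 rfl) := epi_δ_of_isZero hS 1 (isZero_groupCohomology_coind_bot _ 1)
  have := epi_map_H1_freeGroup (Limits.cokernel.π ι)
  exact Limits.IsZero.of_epi_eq_zero _ (δ_eq_zero_of_epi_map hS)

end FreeGroup

section PresentedGroup

variable {k X V : Type u} [CommRing k] [AddCommGroup V] [Module k V] {R : Type*}
  (r : R → FreeGroup X) (ρ : Representation k (PresGroup r) V)

theorem evalInvariantHom_injective :
    Function.Injective (evalInvariantHom (relatorSubgroup r) ρ (relator r)) := by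
  rw [injective_iff_map_eq_zero]
  intro β hβ
  have hconj (s : FreeGroup X) (n : relatorSubgroup r) (hn : β.1 (.ofMul n) = 0) :
      β.1 (.ofMul (MulAut.conjNormal s n)) = 0 := by
    rw [mem_invariantHom_iff.1 β.2, hn, map_zero]
  have hzero (w : FreeGroup X) (hw : w ∈ relatorSubgroup r) : β.1 (.ofMul ⟨w, hw⟩) = 0 := by
    induction hw using Subgroup.closure_induction with
    | mem w hw =>
      obtain ⟨_, ⟨j, rfl⟩, hj⟩ := Group.mem_conjugatesOfSet_iff.1 hw
      obtain ⟨s, rfl⟩ := isConj_iff.1 hj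
      exact hconj s (relator r j) (congrFun hβ j)
    | one => exact map_zero β.1
    | mul s t hs ht ihs iht =>
      exact (map_add β.1 (.ofMul ⟨s, hs⟩) (.ofMul ⟨t, ht⟩)).trans (by rw [ihs, iht, add_zero])
    | inv s hs ihs => exact (map_neg β.1 (.ofMul ⟨s, hs⟩)).trans (by rw [ihs, neg_zero])
  exact Subtype.ext (AddMonoidHom.ext fun n => hzero n.toMul n.toMul.2)

theorem transgression_surjective :
    Function.Surjective (transgression (relatorSubgroup r) ρ) := by
  rw [← LinearMap.range_eq_top, range_transgression, LinearMap.ker_eq_top]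
  exact congrArg ModuleCat.Hom.hom ((isZero_H2_freeGroup _).eq_zero_of_tgt _)

theorem closure_range_presGen : Subgroup.closure (Set.range (presGen r)) = ⊤ := by
  have h : Set.range (presGen r) = QuotientGroup.mk' (relatorSubgroup r) '' Set.range .of :=
    Set.range_comp _ _
  rw [h, ← MonoidHom.map_closure, FreeGroup.closure_range_of, ← MonoidHom.range_eq_map,
    MonoidHom.range_eq_top.2 (QuotientGroup.mk'_surjective _)]

theorem funLeft_presGen_injOn_cocycles₁ :
    Set.InjOn (LinearMap.funLeft k V (presGen r)) (cocycles₁ (Rep.of ρ) : Set (PresGroup r → V)) :=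
  fun c hc d hd h =>
    have hcd : (⟨c, hc⟩ : cocycles₁ (Rep.of ρ)) = ⟨d, hd⟩ :=
      cocycles₁_ext_of_closure_eq_top (closure_range_presGen r) <|
        Set.forall_mem_range.2 <| congrFun h
    congrArg Subtype.val hcd

/-- The map `V^X → V^R` that sends `ξ` to the values at the relators of the 1-cocycle on the free
group with values `ξ` at the generators. Its matrix has as entries the images of Fox's free
derivatives `∂ r j / ∂ x`. -/
def foxDifferential : (X → V) →ₗ[k] (R → V) :=
  evalInvariantHom (relatorSubgroup r) ρ (relator r) ∘ₗ
    cocycleRestriction (relatorSubgroup r) ρ ∘ₗ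
      (freeCocycleEquiv (inflation (relatorSubgroup r) ρ)).symm.toLinearMap

theorem foxDifferential_freeCocycleEquiv (D : cocycles₁ (inflation (relatorSubgroup r) ρ)) :
    foxDifferential r ρ (freeCocycleEquiv _ D) =
      evalInvariantHom (relatorSubgroup r) ρ (relator r)
        (cocycleRestriction (relatorSubgroup r) ρ D) := by
  rw [foxDifferential, LinearMap.comp_apply, LinearMap.comp_apply, LinearEquiv.coe_coe,
    LinearEquiv.symm_apply_apply]

theorem ker_foxDifferential :
    LinearMap.ker (foxDifferential r ρ)
      = (cocycles₁ (Rep.of ρ)).map (LinearMap.funLeft k V (presGen r)) := by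
  ext ξ
  obtain ⟨D, rfl⟩ := (freeCocycleEquiv (inflation (relatorSubgroup r) ρ)).surjective ξ
  have hker : foxDifferential r ρ (freeCocycleEquiv _ D) = 0 ↔
      cocycleRestriction (relatorSubgroup r) ρ D = 0 := by
    rw [foxDifferential_freeCocycleEquiv]
    exact (evalInvariantHom_injective r ρ).eq_iff' (map_zero _)
  rw [LinearMap.mem_ker, hker, cocycleRestriction_eq_zero_iff, Submodule.mem_map]
  refine exists_congr fun c => and_congr_right fun hc => ?_
  let c' : cocycles₁ (inflation (relatorSubgroup r) ρ) :=
    ⟨_, (comp_mem_cocycles₁_res_iff (A := Rep.of ρ) (QuotientGroup.mk'_surjective _)).2 hc⟩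
  calc ⇑D = c ∘ QuotientGroup.mk' _
    _ ↔ c' = D := ⟨fun h => Subtype.ext h.symm, fun h => congrArg Subtype.val h.symm⟩
    _ ↔ freeCocycleEquiv _ c' = freeCocycleEquiv _ D := (freeCocycleEquiv _).injective.eq_iff.symm

theorem range_foxDifferential_le :
    LinearMap.range (foxDifferential r ρ)
      ≤ LinearMap.range (evalInvariantHom (relatorSubgroup r) ρ (relator r)) :=
  LinearMap.range_comp_le_range _ _

theorem range_foxDifferential :
    LinearMap.range (foxDifferential r ρ)
      = (LinearMap.ker (transgression (relatorSubgroup r) ρ)).map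
        (evalInvariantHom (relatorSubgroup r) ρ (relator r)) := by
  rw [foxDifferential, LinearMap.range_comp, LinearEquiv.range_comp, ker_transgression]

theorem finite_invariantHom [IsNoetherianRing k] [Module.Finite k V] [Finite R] :
    Module.Finite k (InvariantHom (relatorSubgroup r) ρ) :=
  Module.Finite.of_injective _ (evalInvariantHom_injective r ρ)

theorem finite_H2_presGroup [IsNoetherianRing k] [Module.Finite k V] [Finite R] :
    Module.Finite k (H2 (Rep.of ρ)) :=
  have := finite_invariantHom r ρ
  Module.Finite.of_surjective _ (transgression_surjective r ρ)

end PresentedGroup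

section Rank

variable {k X V : Type u} [Field k] [AddCommGroup V] [Module k V] [Module.Finite k V]
  {R : Type*} [Finite R] (r : R → FreeGroup X) (ρ : Representation k (PresGroup r) V)

theorem finrank_range_foxDifferential_add_finrank_H2 :
    Module.finrank k (LinearMap.range (foxDifferential r ρ)) + Module.finrank k (H2 (Rep.of ρ))
      = Module.finrank k (InvariantHom (relatorSubgroup r) ρ) := by
  have := finite_invariantHom r ρ
  rw [range_foxDifferential, LinearEquiv.finrank_eq (Submodule.equivMapOfInjective _
      (evalInvariantHom_injective r ρ) _).symm,
    ← LinearMap.finrank_range_add_finrank_ker (transgression (relatorSubgroup r) ρ),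
    LinearMap.range_eq_top.2 (transgression_surjective r ρ), finrank_top, add_comm]

theorem nonempty_quotient_range_foxDifferential_equiv_H2
    (e : InvariantHom (relatorSubgroup r) ρ ≃ₗ[k] (R → V)) :
    Nonempty (((R → V) ⧸ LinearMap.range (foxDifferential r ρ)) ≃ₗ[k] H2 (Rep.of ρ)) := by
  have := finite_H2_presGroup r ρ
  refine ⟨LinearEquiv.ofFinrankEq _ _ ?_⟩
  have h := (LinearMap.range (foxDifferential r ρ)).finrank_quotient_add_finrank
  rw [← e.finrank_eq, ← finrank_range_foxDifferential_add_finrank_H2 r ρ, add_comm] at h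
  exact Nat.add_left_cancel h

end Rank

section PiManifold

variable {𝕜 : Type*} [NontriviallyNormedField 𝕜] {ι : Type*} [Fintype ι]
  {E H M : ι → Type*} [∀ i, NormedAddCommGroup (E i)] [∀ i, NormedSpace 𝕜 (E i)]
  [∀ i, TopologicalSpace (H i)] {I : ∀ i, ModelWithCorners 𝕜 (E i) (H i)}
  [∀ i, TopologicalSpace (M i)] [∀ i, ChartedSpace (H i) (M i)]

theorem hasMFDerivAt_pi_apply (p : ∀ i, M i) (i : ι) :
    HasMFDerivAt (.pi I) (I i) (fun g : ∀ i, M i => g i) p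
      (ContinuousLinearMap.proj i : (∀ i, E i) →L[𝕜] E i) := by
  refine ⟨(continuous_apply i).continuousAt, ?_⟩
  refine HasFDerivWithinAt.congr_of_eventuallyEq
    (ContinuousLinearMap.proj i : (∀ i, E i) →L[𝕜] E i).hasFDerivWithinAt ?_ ?_
  · filter_upwards [extChartAt_target_mem_nhdsWithin (I := .pi I) p] with z hz
    have hzi : z i ∈ (extChartAt (I i) (p i)).target := ⟨hz.1 i trivial, hz.2 i trivial⟩
    exact (extChartAt (I i) (p i)).right_inv hzi
  · exact congrArg (extChartAt (I i) (p i))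
      ((extChartAt (I i) (p i)).left_inv (mem_extChartAt_source _))

variable {E' : Type*} [NormedAddCommGroup E'] [NormedSpace 𝕜 E']
  {H' : Type*} [TopologicalSpace H'] {J : ModelWithCorners 𝕜 E' H'}
  {P : Type*} [TopologicalSpace P] [ChartedSpace H' P]

theorem hasMFDerivAt_pi {f : P → ∀ i, M i} {p : P} {f' : ∀ i, E' →L[𝕜] E i}
    (h : ∀ i, HasMFDerivAt J (I i) (fun m => f m i) p (f' i)) :
    HasMFDerivAt J (.pi I) f p (ContinuousLinearMap.pi f' : E' →L[𝕜] ∀ i, E i) :=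
  ⟨continuousAt_pi.2 fun i => (h i).1, hasFDerivWithinAt_pi.2 fun i => (h i).2⟩

end PiManifold

section RightLogarithmicDerivative

variable {𝕜 : Type*} [NontriviallyNormedField 𝕜]
  {E : Type*} [NormedAddCommGroup E] [NormedSpace 𝕜 E]
  {H : Type*} [TopologicalSpace H] (I : ModelWithCorners 𝕜 E H)
  {G : Type*} [TopologicalSpace G] [ChartedSpace H G]
  {E' : Type*} [NormedAddCommGroup E'] [NormedSpace 𝕜 E']
  {H' : Type*} [TopologicalSpace H'] {J : ModelWithCorners 𝕜 E' H'}
  {M : Type*} [TopologicalSpace M] [ChartedSpace H' M] {u v : M → G} {p : M}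

section Monoid

variable [Monoid G] [ContMDiffMul I 1 G]

theorem mdifferentiableAt_mul (a : G × G) :
    MDifferentiableAt (I.prod I) I (fun a : G × G => a.1 * a.2) a :=
  (contMDiff_mul I 1).mdifferentiableAt one_ne_zero

variable {I}

theorem hasMFDerivAt_mul_one_one :
    HasMFDerivAt (I.prod I) I (fun a : G × G => a.1 * a.2) (1, 1)
      (ContinuousLinearMap.fst 𝕜 E E + ContinuousLinearMap.snd 𝕜 E E : E × E →L[𝕜] E) := by
  have hid : ∀ f : G → G, f = id →
      (mfderiv I I f 1 : E →L[𝕜] E) = ContinuousLinearMap.id 𝕜 E := by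
    rintro _ rfl
    exact mfderiv_id
  have hmul : (mfderiv (I.prod I) I (fun a : G × G => a.1 * a.2) (1, 1) : E × E →L[𝕜] E)
      = ContinuousLinearMap.fst 𝕜 E E + ContinuousLinearMap.snd 𝕜 E E :=
    (mfderiv_prod_eq_add_comp (mdifferentiableAt_mul I (1, 1))).trans
      (congrArg₂ (fun L L' : E →L[𝕜] E => L.comp (ContinuousLinearMap.fst 𝕜 E E)
        + L'.comp (ContinuousLinearMap.snd 𝕜 E E))
        (hid _ (funext mul_one)) (hid _ (funext one_mul)))
  exact hmul ▸ (mdifferentiableAt_mul I ((1, 1) : G × G)).hasMFDerivAt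

theorem hasMFDerivAt_mul_of_eq_one {u' v' : E' →L[𝕜] E}
    (hu : HasMFDerivAt J I u p u') (hv : HasMFDerivAt J I v p v') (hup : u p = 1)
    (hvp : v p = 1) :
    HasMFDerivAt J I (fun m => u m * v m) p (u' + v' : E' →L[𝕜] E) := by
  have hmul : HasMFDerivAt (I.prod I) I (fun a : G × G => a.1 * a.2) (u p, v p)
      (ContinuousLinearMap.fst 𝕜 E E + ContinuousLinearMap.snd 𝕜 E E : E × E →L[𝕜] E) := by
    rw [hup, hvp]
    exact hasMFDerivAt_mul_one_one
  exact hmul.comp p (hu.prodMk hv)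

end Monoid

variable [Group G]

variable (J) in
/-- The right logarithmic derivative `du · u⁻¹` of a map `u` into a Lie group: its differential,
translated back to the identity by a right multiplication. -/
def rightLogDeriv (u : M → G) (p : M) : TangentSpace J p →L[𝕜] GroupLieAlgebra I G :=
  (mfderiv J I (fun m => u m * (u p)⁻¹) p : E' →L[𝕜] E)

variable {I}

theorem hasMFDerivAt_rightLogDeriv_of_eq_one (hu : MDifferentiableAt J I u p) (hp : u p = 1) :
    HasMFDerivAt J I u p (rightLogDeriv I J u p : E' →L[𝕜] E) := by
  have h : (fun m => u m * (u p)⁻¹) = u := funext fun m => by rw [hp, inv_one, mul_one]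
  rw [rightLogDeriv, h]
  exact hu.hasMFDerivAt

variable [ContMDiffMul I 1 G]

theorem hasMFDerivAt_mul_inv_rightLogDeriv (hu : MDifferentiableAt J I u p) :
    HasMFDerivAt J I (fun m => u m * (u p)⁻¹) p (rightLogDeriv I J u p : E' →L[𝕜] E) :=
  ((mdifferentiableAt_mul_right (a := (u p)⁻¹)).comp p hu).hasMFDerivAt

theorem hasMFDerivAt_conj_of_eq_one {v' : E' →L[𝕜] E} (a : G)
    (hv : HasMFDerivAt J I v p v') (hvp : v p = 1) :
    HasMFDerivAt J I (fun m => a * v m * a⁻¹) p ((lieAd I a : E →L[𝕜] E).comp v') := by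
  have hconj : HasMFDerivAt I I (fun h : G => a * h * a⁻¹) (v p) (lieAd I a : E →L[𝕜] E) := by
    rw [hvp]
    exact (mdifferentiableAt_mul_right.comp 1 mdifferentiableAt_mul_left).hasMFDerivAt
  exact hconj.comp p hv

theorem rightLogDeriv_mul (hu : MDifferentiableAt J I u p) (hv : MDifferentiableAt J I v p) :
    rightLogDeriv I J (fun m => u m * v m) p
      = rightLogDeriv I J u p + (lieAd I (u p)).comp (rightLogDeriv I J v p) := by
  have huv : (fun m => u m * v m * (u p * v p)⁻¹)
      = fun m => u m * (u p)⁻¹ * (u p * (v m * (v p)⁻¹) * (u p)⁻¹) := by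
    funext m; simp [mul_assoc]
  have h := hasMFDerivAt_mul_of_eq_one (hasMFDerivAt_mul_inv_rightLogDeriv hu)
    (hasMFDerivAt_conj_of_eq_one (u p) (hasMFDerivAt_mul_inv_rightLogDeriv hv) (mul_inv_cancel _))
    (mul_inv_cancel _) (by simp)
  rw [← huv] at h
  exact h.mfderiv

theorem rightLogDeriv_id_lieTransport (g : G) (ξ : GroupLieAlgebra I G) :
    rightLogDeriv I I id g (lieTransport I g ξ) = ξ := by
  have hg : HasMFDerivAt I I (fun h : G => h * g⁻¹) (1 * g)
      (rightLogDeriv I I id g : E →L[𝕜] E) := by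
    rw [one_mul]
    exact mdifferentiableAt_mul_right.hasMFDerivAt
  have h := hg.comp 1 (mdifferentiableAt_mul_right (a := g)).hasMFDerivAt
  have hid : (fun h : G => h * g⁻¹) ∘ (fun h : G => h * g) = id := by
    funext h; simp
  rw [hid] at h
  exact DFunLike.congr_fun (hasMFDerivAt_unique h (hasMFDerivAt_id 1)) ξ

theorem rightLogDeriv_eval_lieTransportPi {X : Type*} [Fintype X] (p : X → G) (x : X)
    (ξ : X → GroupLieAlgebra I G) :
    rightLogDeriv I (.pi fun _ : X => I) (fun g : X → G => g x) p (lieTransportPi I p ξ) = ξ x := by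
  have h := (mdifferentiableAt_mul_right (I := I) (a := (p x)⁻¹) (b := p x)).hasMFDerivAt.comp p
    (hasMFDerivAt_pi_apply (I := fun _ => I) p x)
  exact (DFunLike.congr_fun h.mfderiv (lieTransportPi I p ξ)).trans
    (rightLogDeriv_id_lieTransport (p x) (ξ x))

end RightLogarithmicDerivative

section WordMap

variable {X R : Type*} {G : Type*} [Group G]

theorem wordMap_homPoint (r : R → FreeGroup X) (φ : PresGroup r →* G) (w : FreeGroup X) :
    wordMap w (homPoint r φ) = φ (w : PresGroup r) := by
  have h : FreeGroup.lift (homPoint r φ) = φ.comp (QuotientGroup.mk' (relatorSubgroup r)) :=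
    FreeGroup.ext_hom _ _ fun x => FreeGroup.lift_apply_of
  exact DFunLike.congr_fun h w

variable {𝕜 : Type*} [NontriviallyNormedField 𝕜]
  {E : Type*} [NormedAddCommGroup E] [NormedSpace 𝕜 E]
  {H : Type*} [TopologicalSpace H] (I : ModelWithCorners 𝕜 E H)
  [TopologicalSpace G] [ChartedSpace H G] [Fintype X]

theorem mdifferentiableAt_wordMap [LieGroup I 1 G] (w : FreeGroup X) (p : X → G) :
    MDifferentiableAt (.pi fun _ : X => I) I (wordMap w) p := by
  induction w using FreeGroup.induction_on with
  | C1 =>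
    have h : wordMap (1 : FreeGroup X) = fun _ : X → G => 1 := funext fun g => map_one _
    exact h ▸ mdifferentiableAt_const
  | of x =>
    have h : wordMap (.of x) = fun g : X → G => g x := funext fun g => FreeGroup.lift_apply_of
    exact h ▸ (hasMFDerivAt_pi_apply p x).mdifferentiableAt
  | inv_of x hx =>
    have h : wordMap (.of x)⁻¹ = (·⁻¹) ∘ (wordMap (.of x) : (X → G) → G) :=
      funext fun g => map_inv _ _
    exact h ▸ ((contMDiff_inv I 1).mdifferentiableAt one_ne_zero).comp p hx
  | mul s t hs ht =>
    have h : wordMap (s * t) = fun g : X → G => wordMap s g * wordMap t g :=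
      funext fun g => map_mul _ _ _
    exact h ▸ (mdifferentiableAt_mul I (wordMap s p, wordMap t p)).comp p (hs.prodMk ht)

variable [Fintype R] (r : R → FreeGroup X) (φ : PresGroup r →* G)

theorem hasMFDerivAt_relatorMap [LieGroup I 1 G] :
    HasMFDerivAt (.pi fun _ : X => I) (.pi fun _ : R => I)
      (relatorMap r : (X → G) → (R → G)) (homPoint r φ)
      (ContinuousLinearMap.pi fun j =>
        rightLogDeriv I (.pi fun _ : X => I) (wordMap (r j)) (homPoint r φ) :
        (X → E) →L[𝕜] (R → E)) :=
  hasMFDerivAt_pi fun j => hasMFDerivAt_rightLogDeriv_of_eq_one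
    (mdifferentiableAt_wordMap I (r j) _) (congrFun (relatorMap_homPoint r φ) j)

theorem relatorDifferential_apply [LieGroup I 1 G] (ξ : X → GroupLieAlgebra I G) (j : R) :
    relatorDifferential I r φ ξ j
      = rightLogDeriv I (.pi fun _ : X => I) (wordMap (r j)) (homPoint r φ)
          (lieTransportPi I (homPoint r φ) ξ) :=
  congrFun (DFunLike.congr_fun (hasMFDerivAt_relatorMap I r φ).mfderiv
    (lieTransportPi I (homPoint r φ) ξ)) j

end WordMap

section RelatorDifferential

variable {𝕜 : Type u} [NontriviallyNormedField 𝕜]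
  {E : Type u} [NormedAddCommGroup E] [NormedSpace 𝕜 E]
  {H : Type*} [TopologicalSpace H] (I : ModelWithCorners 𝕜 E H)
  {G : Type*} [TopologicalSpace G] [ChartedSpace H G] [Group G] [LieGroup I ∞ G]
  {X : Type u} [Fintype X] {R : Type*} (r : R → FreeGroup X) (φ : PresGroup r →* G)

theorem rightLogDeriv_wordMap_mem_cocycles₁ (ξ : X → GroupLieAlgebra I G) :
    (fun w : FreeGroup X => rightLogDeriv I (.pi fun _ : X => I) (wordMap w) (homPoint r φ)
        (lieTransportPi I (homPoint r φ) ξ))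
      ∈ cocycles₁ (inflation (relatorSubgroup r) (adRep I φ)) := by
  refine mem_cocycles₁_inflation_iff.2 fun s t => ?_
  have hst : wordMap (s * t) = fun g : X → G => wordMap s g * wordMap t g :=
    funext fun g => map_mul _ _ _
  rw [hst, rightLogDeriv_mul (mdifferentiableAt_wordMap I s _) (mdifferentiableAt_wordMap I t _),
    wordMap_homPoint, add_comm]
  rfl

theorem relatorDifferential_eq_foxDifferential [Fintype R] :
    relatorDifferential I r φ = foxDifferential r (adRep I φ) := by
  ext1 ξ
  let D : cocycles₁ (inflation (relatorSubgroup r) (adRep I φ)) :=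
    ⟨_, rightLogDeriv_wordMap_mem_cocycles₁ I r φ ξ⟩
  have hD : freeCocycleEquiv _ D = ξ := funext fun x => by
    have hx : wordMap (.of x) = fun g : X → G => g x := funext fun g => FreeGroup.lift_apply_of
    rw [freeCocycleEquiv_apply]
    change rightLogDeriv I (.pi fun _ : X => I) (wordMap (.of x)) _ _ = ξ x
    rw [hx, rightLogDeriv_eval_lieTransportPi]
  funext j
  calc relatorDifferential I r φ ξ j
    _ = D (r j) := relatorDifferential_apply I r φ ξ j
    _ = foxDifferential r (adRep I φ) (freeCocycleEquiv _ D) j := by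
      rw [foxDifferential_freeCocycleEquiv]; rfl
    _ = foxDifferential r (adRep I φ) ξ j := by rw [hD]

end RelatorDifferential

end

theorem theorem3p1_general
    {𝕜 : Type u} [NontriviallyNormedField 𝕜]
    {E : Type u} [NormedAddCommGroup E] [NormedSpace 𝕜 E] [FiniteDimensional 𝕜 E]
    {H : Type*} [TopologicalSpace H] (I : ModelWithCorners 𝕜 E H)
    {G : Type*} [TopologicalSpace G] [ChartedSpace H G] [Group G] [LieGroup I ∞ G]
    {X : Type u} [Fintype X] {R : Type*} [Fintype R] (r : R → FreeGroup X)
    (φ : PresGroup r →* G) :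
    MDifferentiableAt (ModelWithCorners.pi fun _ : X => I) (ModelWithCorners.pi fun _ : R => I)
      (relatorMap r : (X → G) → (R → G)) (homPoint r φ) ∧
    Set.InjOn (LinearMap.funLeft 𝕜 (GroupLieAlgebra I G) (presGen r))
      (groupCohomology.cocycles₁ (Rep.of (adRep I φ)) : Set (PresGroup r → GroupLieAlgebra I G)) ∧
    LinearMap.ker (relatorDifferential I r φ) =
      (groupCohomology.cocycles₁ (Rep.of (adRep I φ))).map
        (LinearMap.funLeft 𝕜 (GroupLieAlgebra I G) (presGen r)) ∧
    Function.Injective (evalInvariantHom (relatorSubgroup r) (adRep I φ) (relator r)) ∧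
    LinearMap.range (relatorDifferential I r φ) ≤
      LinearMap.range (evalInvariantHom (relatorSubgroup r) (adRep I φ) (relator r)) ∧
    Module.Finite 𝕜 (InvariantHom (relatorSubgroup r) (adRep I φ)) ∧
    Module.Finite 𝕜 (groupCohomology.H2 (Rep.of (adRep I φ))) ∧
    (Module.finrank 𝕜 (LinearMap.range (relatorDifferential I r φ)) : ℤ) =
      (Module.finrank 𝕜 (InvariantHom (relatorSubgroup r) (adRep I φ)) : ℤ) -
        (Module.finrank 𝕜 (groupCohomology.H2 (Rep.of (adRep I φ))) : ℤ) ∧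
    (Nonempty (InvariantHom (relatorSubgroup r) (adRep I φ) ≃ₗ[𝕜] (R → GroupLieAlgebra I G)) →
      Nonempty (((R → GroupLieAlgebra I G) ⧸ LinearMap.range (relatorDifferential I r φ))
        ≃ₗ[𝕜] groupCohomology.H2 (Rep.of (adRep I φ)))) := by
  have : FiniteDimensional 𝕜 (GroupLieAlgebra I G) := inferInstanceAs (FiniteDimensional 𝕜 E)
  rw [relatorDifferential_eq_foxDifferential]
  have hrank := finrank_range_foxDifferential_add_finrank_H2 r (adRep I φ)
  exact ⟨(hasMFDerivAt_relatorMap I r φ).mdifferentiableAt,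
    funLeft_presGen_injOn_cocycles₁ r _, ker_foxDifferential r _,
    evalInvariantHom_injective r _, range_foxDifferential_le r _,
    finite_invariantHom r _, finite_H2_presGroup r _, by omega,
    fun ⟨e⟩ => nonempty_quotient_range_foxDifferential_equiv_H2 r _ e⟩

theorem theorem3p1
    {𝕜 : Type u} [RCLike 𝕜]
    {E : Type u} [NormedAddCommGroup E] [NormedSpace 𝕜 E] [FiniteDimensional 𝕜 E]
    {H : Type*} [TopologicalSpace H] (I : ModelWithCorners 𝕜 E H) [I.Boundaryless]
    {G : Type*} [TopologicalSpace G] [ChartedSpace H G] [Group G] [LieGroup I ∞ G]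
    {X : Type u} [Fintype X] {R : Type*} [Fintype R] (r : R → FreeGroup X)
    (φ : PresGroup r →* G) :
    -- the relator map is differentiable at `φ`, so that its differential is meaningful
    MDifferentiableAt (ModelWithCorners.pi fun _ : X => I) (ModelWithCorners.pi fun _ : R => I)
      (relatorMap r : (X → G) → (R → G)) (homPoint r φ) ∧
    -- the restriction to the generators embeds `Z¹(Π, 𝔤)` in `𝔤^X`, with image the kernel
    Set.InjOn (LinearMap.funLeft 𝕜 (GroupLieAlgebra I G) (presGen r))
      (groupCohomology.cocycles₁ (Rep.of (adRep I φ)) : Set (PresGroup r → GroupLieAlgebra I G)) ∧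
    LinearMap.ker (relatorDifferential I r φ) =
      (groupCohomology.cocycles₁ (Rep.of (adRep I φ))).map
        (LinearMap.funLeft 𝕜 (GroupLieAlgebra I G) (presGen r)) ∧
    -- the evaluation at the relators embeds `Hom(N, 𝔤)^Π` in `𝔤^R`; its image contains the
    -- image of the differential
    Function.Injective (evalInvariantHom (relatorSubgroup r) (adRep I φ) (relator r)) ∧
    LinearMap.range (relatorDifferential I r φ) ≤
      LinearMap.range (evalInvariantHom (relatorSubgroup r) (adRep I φ) (relator r)) ∧
    -- the rank formula
    Module.Finite 𝕜 (InvariantHom (relatorSubgroup r) (adRep I φ)) ∧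
    Module.Finite 𝕜 (groupCohomology.H2 (Rep.of (adRep I φ))) ∧
    (Module.finrank 𝕜 (LinearMap.range (relatorDifferential I r φ)) : ℤ) =
      (Module.finrank 𝕜 (InvariantHom (relatorSubgroup r) (adRep I φ)) : ℤ) -
        (Module.finrank 𝕜 (groupCohomology.H2 (Rep.of (adRep I φ))) : ℤ) ∧
    -- the cokernel
    (Nonempty (InvariantHom (relatorSubgroup r) (adRep I φ) ≃ₗ[𝕜] (R → GroupLieAlgebra I G)) →
      Nonempty (((R → GroupLieAlgebra I G) ⧸ LinearMap.range (relatorDifferential I r φ))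
        ≃ₗ[𝕜] groupCohomology.H2 (Rep.of (adRep I φ)))) :=
  theorem3p1_general I r φ
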